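/- Let $\mathcal S$ be the family of all nonempty compact convex subsets of $\mathbb R^2$ that are centrally symmetric about the origin, with Minkowski addition $U+V=\{u+v : u\in U,\ v\in V\}$ and multiplication $\lambda U=\{\lambda u : u\in U\}$ by scalars $\lambda\ge 0$, and let $m(U)$ be the planar Lebesgue measure of $U\in\mathcal S$. Let $X_{\mathcal S}$ be the real vector space of formal differences $[U,V]$ with $U,V\in\mathcal S$, that is, the quotient of $\mathcal S\times\mathcal S$ by the equivalence relation $$(U,V)\diamond(P,Q)\iff U+Q=V+P,$$ with the operations $[U,V]+[P,Q]=[U+P,V+Q]$, $\lambda[U,V]=[\lambda U,\lambda V]$ for $\lambda\ge 0$, and $(-1)[U,V]=[V,U]$. Embed $\mathcal S$ in $X_{\mathcal S}$ by $U\mapsto[U,\{0\}]$. By a polynomial of degree at most two on a real vector space we mean a sum of a quadratic form, a linear form and a constant. **Theorem.** There is a nonzero quadratic form (a homogeneous polynomial of degree two) $m^*:X_{\mathcal S}\to\mathbb R$ such that $m^*([U,\{0\}])=m(U)$ for all $U\in\mathcal S$, and $m^*$ is the only polynomial of degree at most two on $X_{\mathcal S}$, homogeneous or not, with this property. Explicitly,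 $$m^*([U,V])=2m(U)+2m(V)-m(U+V)\qquad(U,V\in\mathcal S).$$ Moreover, the formula $$\widetilde M([U,V],[P,Q])=\frac{m(U+P)+m(V+Q)-m(U+Q)-m(V+P)}{2}$$ gives a well-defined symmetric bilinear form on $X_{\mathcal S}$, and $m^*(x)=\widetilde M(x,x)$ for all $x\in X_{\mathcal S}$. -/

import Mathlib

open MeasureTheory
open scoped Pointwise NNReal

/-- The Euclidean plane. -/
abbrev Plane : Type := EuclideanSpace ℝ (Fin 2)

/-- The cone of nonempty compact convex subsets of the plane that are centrally symmetric
(about the origin), with Minkowski addition and multiplication by nonnegative scalars inherited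
from `ConvexBody Plane`. -/
noncomputable def symBodies : Submodule ℝ≥0 (ConvexBody Plane) where
  carrier := {K | ∀ x ∈ K, -x ∈ K}
  add_mem' := by
    intro K L hK hL x hx
    obtain ⟨a, ha, b, hb, rfl⟩ := Set.mem_add.1 (show x ∈ (K : Set Plane) + L from hx)
    exact Set.mem_add.2 ⟨-a, hK a ha, -b, hL b hb, by abel⟩
  zero_mem' := by
    intro x hx
    have h0 : x = 0 := hx
    subst h0
    show -(0 : Plane) = 0
    simp
  smul_mem' := by
    intro c K hK x hx
    obtain ⟨a, ha, rfl⟩ := Set.mem_smul_set.1 (show x ∈ c • (K : Set Plane) from hx)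
    exact Set.mem_smul_set.2 ⟨-a, hK a ha, smul_neg _ _⟩

/-- The type of nonempty compact convex centrally symmetric planar sets. -/
def SymBody : Type := ↥symBodies

namespace SymBody

noncomputable instance : AddCommMonoid SymBody := Submodule.addCommMonoid symBodies

noncomputable instance : Module ℝ≥0 SymBody := Submodule.module symBodies

/-- The underlying convex body. -/
def toConvexBody (U : SymBody) : ConvexBody Plane := Subtype.val (p := (· ∈ symBodies)) U

theorem neg_mem (U : SymBody) {x : Plane} (hx : x ∈ U.toConvexBody) : -x ∈ U.toConvexBody :=
  Subtype.prop (p := (· ∈ symBodies)) U x hx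

/-- The underlying set of points. -/
def toSet (U : SymBody) : Set Plane := (U.toConvexBody : Set Plane)

/-- A convex body that is symmetric about the origin is a symmetric body. -/
def ofConvexBody (K : ConvexBody Plane) (h : ∀ x ∈ K, -x ∈ K) : SymBody :=
  Subtype.mk (p := (· ∈ symBodies)) K h

theorem toSet_ofConvexBody (K : ConvexBody Plane) (h : ∀ x ∈ K, -x ∈ K) :
    (ofConvexBody K h).toSet = K := rfl

theorem ext_toSet {U V : SymBody} (h : U.toSet = V.toSet) : U = V :=
  Subtype.ext (ConvexBody.ext h)

theorem toSet_add (U V : SymBody) : (U + V).toSet = U.toSet + V.toSet := rfl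

theorem toSet_smul (c : ℝ≥0) (U : SymBody) : (c • U).toSet = (c : ℝ) • U.toSet := rfl

theorem toSet_zero : (0 : SymBody).toSet = {0} := rfl

/-- Planar Lebesgue measure of a body, as a real number. -/
noncomputable def area (U : SymBody) : ℝ := (volume U.toSet).toReal

theorem subset_of_add_eq {U V W : SymBody} (h : U + W = V + W) : U.toSet ⊆ V.toSet := by
  intro x hx
  by_contra hxV
  obtain ⟨f, u, hV, hu⟩ := geometric_hahn_banach_closed_point
    (s := V.toSet) V.toConvexBody.convex V.toConvexBody.isClosed hxV
  obtain ⟨w, hw, hmax⟩ := W.toConvexBody.isCompact.exists_isMaxOn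
    W.toConvexBody.nonempty f.continuous.continuousOn
  have hs : U.toSet + W.toSet = V.toSet + W.toSet := by
    rw [← toSet_add, ← toSet_add, h]
  have hmem : x + w ∈ V.toSet + W.toSet := hs ▸ Set.add_mem_add hx hw
  obtain ⟨v, hv, w', hw', he⟩ := Set.mem_add.1 hmem
  have h1 : f v + f w' = f x + f w := by rw [← map_add, he, map_add]
  have h2 : f w' ≤ f w := hmax hw'
  have h3 := hV v hv
  linarith

/-- The cancellation law for Minkowski addition. -/
theorem add_right_cancel' {U V W : SymBody} (h : U + W = V + W) : U = V :=
  ext_toSet (Set.Subset.antisymm (subset_of_add_eq h) (subset_of_add_eq h.symm))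

end SymBody

/-- Two pairs `(U, V)`, `(P, Q)` represent the same formal difference iff `U + Q = V + P`. -/
def diffSetoid : Setoid (SymBody × SymBody) where
  r x y := x.1 + y.2 = x.2 + y.1
  iseqv :=
    { refl := fun x => add_comm _ _
      symm := fun {x y} h => by rw [add_comm y.1, add_comm y.2]; exact h.symm
      trans := fun {x y z} h₁ h₂ => by
        apply SymBody.add_right_cancel' (W := y.1 + y.2)
        calc x.1 + z.2 + (y.1 + y.2) = (x.1 + y.2) + (y.1 + z.2) := by abel
          _ = (x.2 + y.1) + (y.2 + z.1) := by rw [h₁, h₂]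
          _ = x.2 + z.1 + (y.1 + y.2) := by abel }

/-- The space of formal differences `[U, V]` of symmetric bodies. -/
def DiffSpace : Type := Quotient diffSetoid

namespace DiffSpace

/-- The class `[U, V]`. -/
def mk (U V : SymBody) : DiffSpace := Quotient.mk diffSetoid (U, V)

theorem mk_eq_mk {U V P Q : SymBody} : mk U V = mk P Q ↔ U + Q = V + P :=
  ⟨fun h => Quotient.exact h, fun h => Quotient.sound (s := diffSetoid) h⟩

theorem ind {p : DiffSpace → Prop} (h : ∀ U V, p (mk U V)) (x : DiffSpace) : p x :=
  Quotient.ind (fun a => h a.1 a.2) x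

noncomputable instance : Zero DiffSpace := ⟨mk 0 0⟩

/-- `[U, V] + [P, Q] = [U + P, V + Q]`. -/
noncomputable instance : Add DiffSpace where
  add := Quotient.map₂ (fun a b => (a.1 + b.1, a.2 + b.2)) (by
    intro a a' h b b' h'
    have h1 : a.1 + a'.2 = a.2 + a'.1 := h
    have h2 : b.1 + b'.2 = b.2 + b'.1 := h'
    show (a.1 + b.1) + (a'.2 + b'.2) = (a.2 + b.2) + (a'.1 + b'.1)
    rw [add_add_add_comm, h1, h2, add_add_add_comm])

/-- `-[U, V] = [V, U]`. -/
instance : Neg DiffSpace where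
  neg := Quotient.map (fun a => (a.2, a.1)) (by
    intro a a' h
    have h1 : a.1 + a'.2 = a.2 + a'.1 := h
    exact h1.symm)

/-- `r [U, V] = [r⁺ U + r⁻ V, r⁺ V + r⁻ U]`, where `r⁺` and `r⁻` are the positive and negative
parts of `r`; so `r [U, V] = [r U, r V]` for `0 ≤ r`, and `(-1) [U, V] = [V, U]`. -/
noncomputable instance : SMul ℝ DiffSpace where
  smul r := Quotient.map
    (fun a => (r.toNNReal • a.1 + (-r).toNNReal • a.2, r.toNNReal • a.2 + (-r).toNNReal • a.1)) (by
    intro a a' h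
    have h1 : a.1 + a'.2 = a.2 + a'.1 := h
    show (r.toNNReal • a.1 + (-r).toNNReal • a.2) + (r.toNNReal • a'.2 + (-r).toNNReal • a'.1)
      = (r.toNNReal • a.2 + (-r).toNNReal • a.1) + (r.toNNReal • a'.1 + (-r).toNNReal • a'.2)
    rw [add_add_add_comm, add_add_add_comm (r.toNNReal • a.2), ← smul_add, ← smul_add, ← smul_add,
      ← smul_add, h1])

theorem zero_def : (0 : DiffSpace) = mk 0 0 := rfl

theorem mk_add_mk (U V P Q : SymBody) : mk U V + mk P Q = mk (U + P) (V + Q) := rfl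

theorem neg_mk (U V : SymBody) : -mk U V = mk V U := rfl

theorem smul_mk (r : ℝ) (U V : SymBody) : r • mk U V =
    mk (r.toNNReal • U + (-r).toNNReal • V) (r.toNNReal • V + (-r).toNNReal • U) := rfl

theorem sub_smul_mk (a b : ℝ≥0) (U V : SymBody) :
    ((a : ℝ) - b) • mk U V = mk (a • U + b • V) (a • V + b • U) := by
  rw [smul_mk, mk_eq_mk]
  set p := ((a : ℝ) - b).toNNReal with hp
  set n := (-((a : ℝ) - b)).toNNReal with hn
  have h : p + b = n + a := by
    apply NNReal.coe_injective
    push_cast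
    rw [hp, hn, Real.coe_toNNReal', Real.coe_toNNReal']
    rcases le_total (a : ℝ) b with h | h
    · rw [max_eq_right (by linarith), max_eq_left (by linarith)]; ring
    · rw [max_eq_left (by linarith), max_eq_right (by linarith)]; ring
  calc p • U + n • V + (a • V + b • U) = (p + b) • U + (n + a) • V := by module
    _ = (n + a) • U + (p + b) • V := by rw [h]
    _ = p • V + n • U + (a • U + b • V) := by module

theorem exists_eq_sub (r : ℝ) : ∃ a b : ℝ≥0, r = (a : ℝ) - b := by
  refine ⟨r.toNNReal, (-r).toNNReal, ?_⟩
  rw [Real.coe_toNNReal', Real.coe_toNNReal']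
  rcases le_total r 0 with h | h
  · rw [max_eq_right h, max_eq_left (by linarith)]; ring
  · rw [max_eq_left h, max_eq_right (by linarith)]; ring

theorem nnreal_smul_mk (a : ℝ≥0) (U V : SymBody) : (a : ℝ) • mk U V = mk (a • U) (a • V) := by
  have := sub_smul_mk a 0 U V
  simpa using this

noncomputable instance : AddCommGroup DiffSpace where
  add_assoc x y z := by
    induction x using ind; induction y using ind; induction z using ind
    simp only [mk_add_mk, add_assoc]
  zero_add x := by
    induction x using ind
    simp only [zero_def, mk_add_mk, zero_add]
  add_zero x := by
    induction x using ind
    simp only [zero_def, mk_add_mk, add_zero]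
  add_comm x y := by
    induction x using ind; induction y using ind
    simp only [mk_add_mk, add_comm]
  neg_add_cancel x := by
    induction x using ind
    rw [neg_mk, mk_add_mk, zero_def, mk_eq_mk, add_zero, add_zero, add_comm]
  nsmul := nsmulRec
  zsmul := zsmulRec

noncomputable instance : Module ℝ DiffSpace where
  one_smul x := by
    induction x using ind with | _ U V
    have := nnreal_smul_mk 1 U V
    simpa using this
  mul_smul r s x := by
    induction x using ind with | _ U V
    obtain ⟨a, b, rfl⟩ := exists_eq_sub r
    obtain ⟨c, d, rfl⟩ := exists_eq_sub s
    have h : ((a : ℝ) - b) * ((c : ℝ) - d)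
        = ((a * c + b * d : ℝ≥0) : ℝ) - ((a * d + b * c : ℝ≥0) : ℝ) := by push_cast; ring
    rw [h, sub_smul_mk, sub_smul_mk, sub_smul_mk]
    congr 1 <;> module
  smul_zero r := by
    rw [zero_def, smul_mk]; simp
  zero_smul x := by
    induction x using ind with | _ U V
    have := nnreal_smul_mk 0 U V
    simpa [zero_def] using this
  smul_add r x y := by
    induction x using ind with | _ U V
    induction y using ind with | _ P Q
    obtain ⟨a, b, rfl⟩ := exists_eq_sub r
    rw [mk_add_mk, sub_smul_mk, sub_smul_mk, sub_smul_mk, mk_add_mk]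
    congr 1 <;> module
  add_smul r s x := by
    induction x using ind with | _ U V
    obtain ⟨a, b, rfl⟩ := exists_eq_sub r
    obtain ⟨c, d, rfl⟩ := exists_eq_sub s
    have h : ((a : ℝ) - b) + ((c : ℝ) - d)
        = ((a + c : ℝ≥0) : ℝ) - ((b + d : ℝ≥0) : ℝ) := by push_cast; ring
    rw [h, sub_smul_mk, sub_smul_mk, sub_smul_mk, mk_add_mk]
    congr 1 <;> module

/-- The canonical embedding `U ↦ [U, {0}]` of the cone of bodies. -/
noncomputable def embed (U : SymBody) : DiffSpace := mk U 0

end DiffSpace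

/-- A (not necessarily homogeneous) polynomial function of degree at most two on a real vector
space: the sum of a quadratic form, a linear form and a constant. -/
def IsPolyOfDegreeLETwo {X : Type*} [AddCommGroup X] [Module ℝ X] (w : X → ℝ) : Prop :=
  ∃ (q : QuadraticForm ℝ X) (l : X →ₗ[ℝ] ℝ) (c : ℝ), ∀ x, w x = q x + l x + c

/-! Everything rests on bilinearity of the mixed area V(U, W) = (m(U + W) - m(U) - m(W)) / 2 on the
cone of symmetric bodies. Such a form extends linearly in each argument to formal differences, and
m* is its diagonal.

Let h_U be the support function of U. If W is a segment of half-length c orthogonal to the direction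
φ, slicing parallel to W gives m(U + W) = m(U) + 4 c h_U(φ) (`area_add_orthSeg`). Hence V(U, W) = 2
c h_U(φ), which is linear in U because h_U is. Linearity in U survives addition of bodies W
(`HasLinearMixedArea.add`), so it holds for zonotopes, the finite sums of segments. In the plane
every symmetric body is a limit of zonotopes containing it (`exists_zonotope_approx`), and area
passes to this limit (`tendsto_area_add`), so V is linear for every W.

The approximation discretises the formula h(θ) = ½ ∫ |sin(θ - φ)| (h + h'')(φ) dφ over a half-turn:
second differences of h_U on a grid of directions are nonnegative, and the segments with these
lengths sum to a zonotope whose support function agrees with h_U on the grid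
(`sum_edge_mul_abs_sin`).

For uniqueness, a polynomial q + l + c extending m is compared with t² m(U) on each ray t ↦ tU. This
forces c = 0, l = 0 and q = m on bodies, and the parallelogram identity then gives q on differences.
-/

/-! ### Slicing: adding a horizontal segment. -/

/-- The area of a compact planar set with convex horizontal sections grows under Minkowski addition
of a horizontal segment by the length of the segment times the height of the set. -/
theorem volume_add_horizontal_segment {K : Set (ℝ × ℝ)} (hK : IsCompact K) (hc : Convex ℝ K)
    {s : ℝ} (hs : 0 ≤ s) :
    volume (K + Set.Icc (-s) s ×ˢ {(0 : ℝ)})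
      = volume K + ENNReal.ofReal (2 * s) * volume (Prod.snd '' K) := by
  have hKS : IsCompact (K + Set.Icc (-s) s ×ˢ {(0 : ℝ)}) :=
    hK.add (isCompact_Icc.prod isCompact_singleton)
  have hP : IsCompact (Prod.snd '' K) := hK.image continuous_snd
  rw [Measure.volume_eq_prod, Measure.prod_apply_symm hKS.measurableSet,
    Measure.prod_apply_symm hK.measurableSet, ← lintegral_indicator_const hP.measurableSet,
    ← lintegral_add_left (measurable_measure_prodMk_right hK.measurableSet)]
  refine lintegral_congr fun y => ?_
  have hslice : (fun x => (x, y)) ⁻¹' (K + Set.Icc (-s) s ×ˢ {(0 : ℝ)})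
      = (fun x => (x, y)) ⁻¹' K + Set.Icc (-s) s := by
    ext x
    simp only [Set.mem_preimage, Set.mem_add, Set.mem_prod, Prod.exists, Prod.mk_add_mk,
      Prod.mk.injEq, Set.mem_singleton_iff]
    constructor
    · rintro ⟨a, b, hab, t, z, ⟨ht, rfl⟩, rfl, rfl⟩
      exact ⟨a, by simpa using hab, t, ht, rfl⟩
    · rintro ⟨a, ha, t, ht, rfl⟩
      exact ⟨a, y, ha, t, 0, ⟨ht, rfl⟩, rfl, by simp⟩
  rw [hslice]
  -- A nonempty slice is a compact interval and lengthens by 2s; an empty one stays empty. This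
  -- produces the indicator of the projection.
  by_cases hy : y ∈ Prod.snd '' K
  · have hcl : IsCompact ((fun x : ℝ => (x, y)) ⁻¹' K) := by
      have : (fun x : ℝ => (x, y)) ⁻¹' K = Prod.fst '' (K ∩ Prod.snd ⁻¹' {y}) := by
        ext x
        simp
      rw [this]
      exact (hK.inter_right (isClosed_singleton.preimage continuous_snd)).image continuous_fst
    have hcv : Convex ℝ ((fun x : ℝ => (x, y)) ⁻¹' K) := by
      intro a ha b hb p q hp hq hpq
      have := hc ha hb hp hq hpq
      have e : p • (a, y) + q • (b, y) = (p • a + q • b, y) := by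
        simp [← add_mul, hpq]
      rwa [e] at this
    have hne : ((fun x : ℝ => (x, y)) ⁻¹' K).Nonempty := by
      obtain ⟨⟨x, y⟩, h, rfl⟩ := hy
      exact ⟨x, h⟩
    obtain ⟨a, b, hab, he⟩ : ∃ a b : ℝ, a ≤ b ∧ (fun x : ℝ => (x, y)) ⁻¹' K = Set.Icc a b := by
      have h := eq_Icc_of_connected_compact ⟨hne, hcv.isPreconnected⟩ hcl
      exact ⟨_, _, Set.nonempty_Icc.1 (h ▸ hne), h⟩
    rw [he, Set.Icc_add_Icc hab (by linarith), Set.indicator_of_mem hy, Real.volume_Icc,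
      Real.volume_Icc, ← ENNReal.ofReal_add (by linarith) (by linarith)]
    congr 1
    ring
  · have he : (fun x : ℝ => (x, y)) ⁻¹' K = ∅ := by
      ext x
      simp only [Set.mem_preimage, Set.mem_empty_iff_false, iff_false]
      exact fun h => hy ⟨(x, y), h, rfl⟩
    rw [he, Set.indicator_of_notMem hy]
    simp

/-! ### Directions and rotated coordinates. -/

/-- The inner product with the unit vector of direction `θ`. -/
noncomputable def dirForm (θ : ℝ) : Plane →ₗ[ℝ] ℝ where
  toFun x := x 0 * Real.cos θ + x 1 * Real.sin θ
  map_add' x y := by simp; ring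
  map_smul' c x := by simp; ring

theorem dirForm_apply (θ : ℝ) (x : Plane) :
    dirForm θ x = x 0 * Real.cos θ + x 1 * Real.sin θ := rfl

theorem continuous_dirForm (θ : ℝ) : Continuous (dirForm θ) :=
  (dirForm θ).continuous_of_finiteDimensional

/-- The coordinates of a point in the frame rotated so that the second axis has direction `φ`. -/
noncomputable def rotatedCoords (φ : ℝ) : Plane →ₗ[ℝ] ℝ × ℝ :=
  (dirForm (φ + Real.pi / 2)).prod (dirForm φ)

theorem rotatedCoords_apply (φ : ℝ) (x : Plane) : rotatedCoords φ x =
    (-x 0 * Real.sin φ + x 1 * Real.cos φ, x 0 * Real.cos φ + x 1 * Real.sin φ) := by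
  simp [rotatedCoords, dirForm_apply, Real.cos_add_pi_div_two, Real.sin_add_pi_div_two]

theorem rotatedCoords_injective (φ : ℝ) : Function.Injective (rotatedCoords φ) := by
  rw [← LinearMap.ker_eq_bot, LinearMap.ker_eq_bot']
  intro x hx
  rw [rotatedCoords_apply, Prod.mk_eq_zero] at hx
  have h := Real.sin_sq_add_cos_sq φ
  ext i
  fin_cases i
  · show x 0 = 0
    linear_combination (-Real.sin φ) * hx.1 + Real.cos φ * hx.2 - x 0 * h
  · show x 1 = 0
    linear_combination (Real.cos φ) * hx.1 + Real.sin φ * hx.2 - x 1 * h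

theorem measurePreserving_rotatedCoords (φ : ℝ) :
    MeasurePreserving (rotatedCoords φ) volume volume := by
  -- `ℝ × ℝ` carries the sup norm, so the rotation is an isometry only as a map into `Plane`; the
  -- measure-preserving identification with the product follows.
  let L : Plane →ₗᵢ[ℝ] Plane :=
    { toFun := fun x => !₂[(rotatedCoords φ x).1, (rotatedCoords φ x).2]
      map_add' := fun x y => by
        ext i
        fin_cases i <;> simp
      map_smul' := fun c x => by
        ext i
        fin_cases i <;> simp
      norm_map' := fun x => by
        rw [← sq_eq_sq₀ (norm_nonneg _) (norm_nonneg _), EuclideanSpace.real_norm_sq_eq,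
          EuclideanSpace.real_norm_sq_eq, Fin.sum_univ_two, Fin.sum_univ_two]
        simp only [LinearMap.coe_mk, AddHom.coe_mk, rotatedCoords_apply]
        simp
        linear_combination (x 0 ^ 2 + x 1 ^ 2) * Real.sin_sq_add_cos_sq φ }
  have h := ((volume_preserving_finTwoArrow ℝ).comp
    (PiLp.volume_preserving_ofLp (Fin 2))).comp (L.toLinearIsometryEquiv rfl).measurePreserving
  exact h

/-! ### Support functions and segments. -/

namespace SymBody

/-- The support function in the direction `θ`. -/
noncomputable def supp (U : SymBody) (θ : ℝ) : ℝ := sSup (dirForm θ '' U.toSet)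

theorem isCompact_toSet (U : SymBody) : IsCompact U.toSet := U.toConvexBody.isCompact

theorem convex_toSet (U : SymBody) : Convex ℝ U.toSet := U.toConvexBody.convex

theorem nonempty_toSet (U : SymBody) : U.toSet.Nonempty := U.toConvexBody.nonempty

theorem neg_mem_toSet (U : SymBody) {x : Plane} (hx : x ∈ U.toSet) : -x ∈ U.toSet := U.neg_mem hx

theorem zero_mem_toSet (U : SymBody) : 0 ∈ U.toSet :=
  U.toConvexBody.zero_mem_of_symmetric fun _ => U.neg_mem

theorem isGreatest_supp (U : SymBody) (θ : ℝ) : IsGreatest (dirForm θ '' U.toSet) (U.supp θ) :=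
  (U.isCompact_toSet.image (continuous_dirForm θ)).isGreatest_sSup (U.nonempty_toSet.image _)

theorem dirForm_le_supp {U : SymBody} {x : Plane} (hx : x ∈ U.toSet) (θ : ℝ) :
    dirForm θ x ≤ U.supp θ := (U.isGreatest_supp θ).2 ⟨x, hx, rfl⟩

theorem exists_dirForm_eq_supp (U : SymBody) (θ : ℝ) : ∃ x ∈ U.toSet, dirForm θ x = U.supp θ :=
  (U.isGreatest_supp θ).1

theorem supp_nonneg (U : SymBody) (θ : ℝ) : 0 ≤ U.supp θ := by
  simpa using dirForm_le_supp U.zero_mem_toSet θ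

theorem supp_add (U V : SymBody) (θ : ℝ) : (U + V).supp θ = U.supp θ + V.supp θ := by
  refine ((U + V).isGreatest_supp θ).unique ⟨?_, ?_⟩
  · obtain ⟨x, hx, hx'⟩ := U.exists_dirForm_eq_supp θ
    obtain ⟨y, hy, hy'⟩ := V.exists_dirForm_eq_supp θ
    exact ⟨x + y, Set.add_mem_add hx hy, by rw [map_add, hx', hy']⟩
  · rintro _ ⟨z, hz, rfl⟩
    obtain ⟨x, hx, y, hy, rfl⟩ := Set.mem_add.1 (toSet_add U V ▸ hz)
    rw [map_add]
    exact add_le_add (dirForm_le_supp hx θ) (dirForm_le_supp hy θ)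

theorem supp_smul (c : ℝ≥0) (U : SymBody) (θ : ℝ) : (c • U).supp θ = c * U.supp θ := by
  refine ((c • U).isGreatest_supp θ).unique ⟨?_, ?_⟩
  · obtain ⟨x, hx, hx'⟩ := U.exists_dirForm_eq_supp θ
    exact ⟨(c : ℝ) • x, Set.smul_mem_smul_set hx, by rw [map_smul, hx', smul_eq_mul]⟩
  · rintro _ ⟨z, hz, rfl⟩
    obtain ⟨x, hx, rfl⟩ := Set.mem_smul_set.1 (toSet_smul c U ▸ hz)
    rw [map_smul, smul_eq_mul]
    exact mul_le_mul_of_nonneg_left (dirForm_le_supp hx θ) c.2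

theorem supp_zero (θ : ℝ) : (0 : SymBody).supp θ = 0 := by
  simpa using supp_smul 0 0 θ

theorem image_dirForm (U : SymBody) (θ : ℝ) :
    dirForm θ '' U.toSet = Set.Icc (-U.supp θ) (U.supp θ) := by
  obtain ⟨x, hx, hx'⟩ := U.exists_dirForm_eq_supp θ
  refine Set.Subset.antisymm ?_ ?_
  · rintro _ ⟨z, hz, rfl⟩
    have := dirForm_le_supp (U.neg_mem_toSet hz) θ
    rw [map_neg] at this
    exact ⟨by linarith, dirForm_le_supp hz θ⟩
  · refine Set.OrdConnected.out (U.convex_toSet.linear_image (dirForm θ)).ordConnected ?_ ?_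
    · exact ⟨-x, U.neg_mem_toSet hx, by rw [map_neg, hx']⟩
    · exact ⟨x, hx, hx'⟩

/-- The segment from `-v` to `v`. -/
noncomputable def seg (v : Plane) : SymBody :=
  ofConvexBody
    { carrier := segment ℝ (-v) v
      convex' := convex_segment _ _
      isCompact' := by
        rw [segment_eq_image_lineMap]
        exact isCompact_Icc.image (by fun_prop)
      nonempty' := ⟨v, right_mem_segment _ _ _⟩ } (by
    intro x hx
    obtain ⟨a, b, ha, hb, hab, rfl⟩ := hx
    exact ⟨b, a, hb, ha, by rw [add_comm, hab], by module⟩)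

theorem toSet_seg (v : Plane) : (seg v).toSet = segment ℝ (-v) v := rfl

theorem mem_toSet_seg {v x : Plane} : x ∈ (seg v).toSet ↔ ∃ t ∈ Set.Icc (-1 : ℝ) 1, x = t • v := by
  rw [toSet_seg]
  constructor
  · rintro ⟨a, b, ha, hb, hab, rfl⟩
    exact ⟨b - a, ⟨by linarith, by linarith⟩, by module⟩
  · rintro ⟨t, ⟨h1, h2⟩, rfl⟩
    exact ⟨(1 - t) / 2, (1 + t) / 2, by linarith, by linarith, by ring, by module⟩

theorem supp_seg (v : Plane) (θ : ℝ) : (seg v).supp θ = |dirForm θ v| := by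
  refine ((seg v).isGreatest_supp θ).unique ⟨?_, ?_⟩
  · rcases abs_choice (dirForm θ v) with h | h <;> rw [h]
    · exact ⟨v, right_mem_segment _ _ _, rfl⟩
    · exact ⟨-v, left_mem_segment _ _ _, map_neg _ _⟩
  · rintro _ ⟨z, hz, rfl⟩
    obtain ⟨t, ht, rfl⟩ := mem_toSet_seg.1 hz
    rw [map_smul, smul_eq_mul]
    calc t * dirForm θ v ≤ |t| * |dirForm θ v| := by
          rw [← abs_mul]; exact le_abs_self _
      _ ≤ 1 * |dirForm θ v| := by
          gcongr
          exact abs_le.2 ht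
      _ = _ := one_mul _

/-- The segment of half-length `c` orthogonal to the direction `φ`. -/
noncomputable def orthSeg (φ c : ℝ) : SymBody := seg !₂[-(c * Real.sin φ), c * Real.cos φ]

theorem supp_orthSeg (φ : ℝ) {c : ℝ} (hc : 0 ≤ c) (θ : ℝ) :
    (orthSeg φ c).supp θ = c * |Real.sin (θ - φ)| := by
  rw [orthSeg, supp_seg, dirForm_apply, Real.sin_sub, ← abs_of_nonneg hc, ← abs_mul,
    abs_of_nonneg hc]
  congr 1
  simp
  ring

theorem rotatedCoords_image_orthSeg (φ : ℝ) {c : ℝ} (hc : 0 ≤ c) :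
    rotatedCoords φ '' (orthSeg φ c).toSet = Set.Icc (-c) c ×ˢ {(0 : ℝ)} := by
  have hv : rotatedCoords φ !₂[-(c * Real.sin φ), c * Real.cos φ] = (c, 0) := by
    rw [rotatedCoords_apply]
    ext
    · simp
      linear_combination c * Real.sin_sq_add_cos_sq φ
    · simp
      ring
  ext ⟨a, b⟩
  simp only [orthSeg, Set.mem_image, mem_toSet_seg, Set.mem_prod, Set.mem_singleton_iff]
  constructor
  · rintro ⟨_, ⟨t, ht, rfl⟩, h⟩
    rw [map_smul, hv] at h
    simp only [Prod.smul_mk, smul_eq_mul, mul_zero, Prod.mk.injEq] at h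
    obtain ⟨rfl, rfl⟩ := h
    exact ⟨⟨by nlinarith [ht.1], by nlinarith [ht.2]⟩, rfl⟩
  · rintro ⟨⟨h1, h2⟩, rfl⟩
    rcases hc.eq_or_lt with rfl | hc
    · refine ⟨_, ⟨0, by simp, rfl⟩, ?_⟩
      have : a = 0 := by linarith
      simp [this]
      rfl
    · refine ⟨_, ⟨a / c, ⟨?_, ?_⟩, rfl⟩, ?_⟩
      · rw [le_div_iff₀ hc]; linarith
      · rw [div_le_iff₀ hc]; linarith
      · rw [map_smul, hv]
        simp [hc.ne']

theorem volume_toSet_ne_top (U : SymBody) : volume U.toSet ≠ ⊤ := U.isCompact_toSet.measure_ne_top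

theorem volume_rotatedCoords_image (φ : ℝ) (U : SymBody) :
    volume (rotatedCoords φ '' U.toSet) = volume U.toSet := by
  have h : IsCompact (rotatedCoords φ '' U.toSet) :=
    U.isCompact_toSet.image (rotatedCoords φ).continuous_of_finiteDimensional
  rw [← (measurePreserving_rotatedCoords φ).measure_preimage h.measurableSet.nullMeasurableSet,
    (rotatedCoords_injective φ).preimage_image]

/-- In the rotated frame the segment is horizontal of length 2c, and by symmetry the projection of U
to the second axis has length twice its support value. -/
theorem area_add_orthSeg (U : SymBody) (φ : ℝ) {c : ℝ} (hc : 0 ≤ c) :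
    (U + orthSeg φ c).area = U.area + 4 * c * U.supp φ := by
  have hs : Prod.snd '' (rotatedCoords φ '' U.toSet) = Set.Icc (-U.supp φ) (U.supp φ) := by
    rw [← image_dirForm, Set.image_image]
    rfl
  have h : volume (U + orthSeg φ c).toSet = volume U.toSet
      + ENNReal.ofReal (2 * c) * ENNReal.ofReal (2 * U.supp φ) := by
    rw [← volume_rotatedCoords_image φ, toSet_add, Set.image_add, rotatedCoords_image_orthSeg φ hc,
      volume_add_horizontal_segment
        (U.isCompact_toSet.image (rotatedCoords φ).continuous_of_finiteDimensional)
        (U.convex_toSet.linear_image _) hc, volume_rotatedCoords_image, hs, Real.volume_Icc]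
    congr 3
    ring
  have hn := U.supp_nonneg φ
  rw [area, h, ENNReal.toReal_add U.volume_toSet_ne_top (by finiteness), ENNReal.toReal_mul,
    ENNReal.toReal_ofReal (by positivity), ENNReal.toReal_ofReal (by positivity), area]
  ring

/-- Containment of symmetric bodies follows from the comparison of support functions. -/
theorem subset_of_supp_le {U V : SymBody} (h : ∀ θ, 0 ≤ θ → U.supp θ ≤ V.supp θ) :
    U.toSet ⊆ V.toSet := by
  intro x hx
  by_contra hxV
  obtain ⟨f, u, hV, hu⟩ := geometric_hahn_banach_closed_point V.convex_toSet
    V.isCompact_toSet.isClosed hxV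
  set z : ℂ := ⟨f (EuclideanSpace.single 0 1), f (EuclideanSpace.single 1 1)⟩ with hz
  -- The shift by 2π makes the angle nonnegative, since `h` covers only θ ≥ 0; that restriction
  -- later allows grid points to be indexed by naturals.
  have hf : ∀ y, f y = ‖z‖ * dirForm (z.arg + 2 * Real.pi) y := by
    intro y
    have hy : y = y 0 • EuclideanSpace.single 0 1 + y 1 • EuclideanSpace.single 1 1 := by
      ext i
      fin_cases i <;> simp
    have h0 := Complex.norm_mul_cos_arg z
    have h1 := Complex.norm_mul_sin_arg z
    conv_lhs => rw [hy]
    rw [map_add, map_smul, map_smul, dirForm_apply, Real.cos_add_two_pi, Real.sin_add_two_pi,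
      smul_eq_mul, smul_eq_mul]
    have e0 : z.re = f (EuclideanSpace.single 0 1) := rfl
    have e1 : z.im = f (EuclideanSpace.single 1 1) := rfl
    rw [← e0, ← e1, ← h0, ← h1]
    ring
  obtain ⟨y, hy, hy'⟩ := V.exists_dirForm_eq_supp (z.arg + 2 * Real.pi)
  have h1 := hV y hy
  rw [hf, hy'] at h1
  rw [hf] at hu
  have h2 := (dirForm_le_supp hx (z.arg + 2 * Real.pi)).trans
    (h _ (by linarith [Complex.neg_pi_lt_arg z, Real.pi_pos]))
  have := mul_le_mul_of_nonneg_left h2 (norm_nonneg z)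
  linarith

theorem exists_coord_bound (U : SymBody) :
    ∃ R, 0 < R ∧ ∀ x ∈ U.toSet, |x 0| ≤ R ∧ |x 1| ≤ R := by
  obtain ⟨R, hR, h⟩ := U.isCompact_toSet.isBounded.exists_pos_norm_le
  exact ⟨R, hR, fun x hx => ⟨(PiLp.norm_apply_le x 0).trans (h x hx),
    (PiLp.norm_apply_le x 1).trans (h x hx)⟩⟩

theorem supp_add_pi (U : SymBody) (θ : ℝ) : U.supp (θ + Real.pi) = U.supp θ := by
  have h : ∀ x, dirForm (θ + Real.pi) x = dirForm θ (-x) := by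
    intro x
    simp [dirForm_apply]
  refine (U.isGreatest_supp (θ + Real.pi)).unique ⟨?_, ?_⟩
  · obtain ⟨x, hx, hx'⟩ := U.exists_dirForm_eq_supp θ
    exact ⟨-x, U.neg_mem_toSet hx, by rw [h, neg_neg, hx']⟩
  · rintro _ ⟨x, hx, rfl⟩
    rw [h]
    exact dirForm_le_supp (U.neg_mem_toSet hx) θ

/-- The unit vectors of directions θ + δ and θ - δ add up to 2 cos δ times that of θ; test them at a
point of U extremal for θ. This is the discrete form of h + h'' ≥ 0 and makes the edge lengths
nonnegative. -/
theorem two_mul_cos_mul_supp_le (U : SymBody) (θ δ : ℝ) :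
    2 * Real.cos δ * U.supp θ ≤ U.supp (θ + δ) + U.supp (θ - δ) := by
  obtain ⟨x, hx, hx'⟩ := U.exists_dirForm_eq_supp θ
  have h1 := dirForm_le_supp hx (θ + δ)
  have h2 := dirForm_le_supp hx (θ - δ)
  rw [← hx']
  simp only [dirForm_apply, Real.cos_add, Real.cos_sub, Real.sin_add, Real.sin_sub] at h1 h2 ⊢
  linarith

theorem supp_le_of_coord_bound {U : SymBody} {R : ℝ}
    (h : ∀ x ∈ U.toSet, |x 0| ≤ R ∧ |x 1| ≤ R) (θ : ℝ) : U.supp θ ≤ 2 * R := by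
  obtain ⟨x, hx, hx'⟩ := U.exists_dirForm_eq_supp θ
  rw [← hx', dirForm_apply]
  obtain ⟨h0, h1⟩ := h x hx
  have a0 : |x 0 * Real.cos θ| ≤ R * 1 := by
    rw [abs_mul]; exact mul_le_mul h0 (Real.abs_cos_le_one θ) (abs_nonneg _) ((abs_nonneg _).trans h0)
  have a1 : |x 1 * Real.sin θ| ≤ R * 1 := by
    rw [abs_mul]; exact mul_le_mul h1 (Real.abs_sin_le_one θ) (abs_nonneg _) ((abs_nonneg _).trans h1)
  linarith [le_abs_self (x 0 * Real.cos θ), le_abs_self (x 1 * Real.sin θ)]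

theorem supp_sub_supp_le {U : SymBody} {R : ℝ} (h : ∀ x ∈ U.toSet, |x 0| ≤ R ∧ |x 1| ≤ R)
    (θ θ' : ℝ) : U.supp θ - U.supp θ' ≤ 2 * R * |θ - θ'| := by
  obtain ⟨x, hx, hx'⟩ := U.exists_dirForm_eq_supp θ
  have h2 := dirForm_le_supp hx θ'
  obtain ⟨h0, h1⟩ := h x hx
  have a0 : |x 0 * (Real.cos θ - Real.cos θ')| ≤ R * |θ - θ'| := by
    rw [abs_mul]; exact mul_le_mul h0 (Real.abs_cos_sub_cos_le θ θ') (abs_nonneg _) ((abs_nonneg _).trans h0)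
  have a1 : |x 1 * (Real.sin θ - Real.sin θ')| ≤ R * |θ - θ'| := by
    rw [abs_mul]; exact mul_le_mul h1 (Real.abs_sin_sub_sin_le θ θ') (abs_nonneg _) ((abs_nonneg _).trans h1)
  rw [← hx']
  simp only [dirForm_apply] at h2 ⊢
  linarith [le_abs_self (x 0 * (Real.cos θ - Real.cos θ')),
    le_abs_self (x 1 * (Real.sin θ - Real.sin θ'))]

theorem supp_sum {ι : Type*} (s : Finset ι) (f : ι → SymBody) (θ : ℝ) :
    (∑ i ∈ s, f i).supp θ = ∑ i ∈ s, (f i).supp θ := by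
  classical
  induction s using Finset.induction_on with
  | empty => simp [supp_zero]
  | insert a s ha ih => rw [Finset.sum_insert ha, Finset.sum_insert ha, supp_add, ih]

end SymBody

/-! ### Discrete summation formulas. -/

theorem Function.Periodic.sum_range_add {f : ℕ → ℝ} {n : ℕ} (hf : f.Periodic n) (j : ℕ) :
    ∑ k ∈ Finset.range n, f (k + j) = ∑ k ∈ Finset.range n, f k := by
  induction j with
  | zero => simp
  | succ j ih =>
    have h1 := Finset.sum_range_succ (fun k => f (k + j)) n
    have h2 := Finset.sum_range_succ' (fun k => f (k + j)) n
    have h3 : f (n + j) = f j := by rw [add_comm]; exact hf j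
    simp only [zero_add, h3, add_right_comm _ 1 j] at h1 h2
    rw [← ih]
    simp only [← add_assoc]
    linarith

/-- Summation by parts of a discrete second difference against a sine. -/
theorem sum_second_difference_mul_sin (g : ℝ → ℝ) (δ : ℝ) (n : ℕ) :
    ∑ i ∈ Finset.range n, (g ((i + 1) * δ) + g ((i - 1) * δ) - 2 * Real.cos δ * g (i * δ))
        * Real.sin (i * δ)
      = g (n * δ) * Real.sin ((n - 1) * δ) - g ((n - 1) * δ) * Real.sin (n * δ)
        + g 0 * Real.sin δ := by
  induction n with
  | zero => simp
  | succ n ih =>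
    rw [Finset.sum_range_succ, ih]
    push_cast
    -- The sine satisfies sin((n+1)δ) + sin((n-1)δ) = 2 cos δ sin(nδ), so only boundary terms
    -- remain.
    rw [add_sub_cancel_right, sub_mul, add_mul, one_mul, Real.sin_add, Real.sin_sub]
    ring

/-! ### Approximation by zonotopes. -/

namespace SymBody

/-- The lengths of the edges, up to a factor, of the polygon circumscribed to `U` with the `2 n`
equally spaced normal directions `k δ`. -/
noncomputable def edge (U : SymBody) (δ : ℝ) (k : ℕ) : ℝ :=
  (U.supp ((k + 1) * δ) + U.supp ((k - 1) * δ) - 2 * Real.cos δ * U.supp (k * δ))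
    / (2 * Real.sin δ)

theorem edge_nonneg (U : SymBody) {δ : ℝ} (hδ : 0 < Real.sin δ) (k : ℕ) : 0 ≤ U.edge δ k := by
  have := U.two_mul_cos_mul_supp_le (k * δ) δ
  rw [edge, add_mul, sub_mul, one_mul]
  exact div_nonneg (by linarith) (by linarith)

/-- On π-periodic grid functions |sin| is, up to the factor 2 sin δ, the Green's function of the
second difference defining `edge`. -/
theorem sum_edge_mul_abs_sin (U : SymBody) {n : ℕ} (hn : 2 ≤ n) (j : ℕ) :
    ∑ k ∈ Finset.range n, U.edge (Real.pi / n) k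
      * |Real.sin (j * (Real.pi / n) - k * (Real.pi / n))| = U.supp (j * (Real.pi / n)) := by
  have hn0 : (0 : ℝ) < n := by positivity
  have hn2 : (2 : ℝ) ≤ n := by exact_mod_cast hn
  set δ := Real.pi / n with hδ
  have hnδ : n * δ = Real.pi := by rw [hδ]; field_simp
  have hδ0 : 0 < δ := by positivity
  have hsin : 0 < Real.sin δ :=
    Real.sin_pos_of_pos_of_lt_pi hδ0 (by rw [← hnδ]; nlinarith)
  have hper : Function.Periodic
      (fun k : ℕ => U.edge δ k * |Real.sin (j * δ - k * δ)|) n := by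
    intro k
    have e1 : (((k + n : ℕ) : ℝ) + 1) * δ = (k + 1) * δ + Real.pi := by push_cast; linarith
    have e2 : (((k + n : ℕ) : ℝ) - 1) * δ = (k - 1) * δ + Real.pi := by push_cast; linarith
    have e3 : ((k + n : ℕ) : ℝ) * δ = k * δ + Real.pi := by push_cast; linarith
    simp only [edge]
    rw [e1, e2, e3, supp_add_pi, supp_add_pi, supp_add_pi, ← sub_sub, Real.sin_sub_pi, abs_neg]
  -- The summand has period n in k, so the window may start at j; the angles then run through [0, π)
  -- and the absolute value can be dropped.
  rw [← hper.sum_range_add j]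
  have key := sum_second_difference_mul_sin (fun t => U.supp (t + j * δ)) δ n
  have h1 : U.supp (n * δ + j * δ) = U.supp (j * δ) := by
    rw [hnδ, add_comm, supp_add_pi]
  -- Both surviving boundary terms equal sin δ times the support value at jδ, which cancels the
  -- normalisation 2 sin δ.
  rw [h1, sub_mul (n : ℝ), hnδ, one_mul, Real.sin_pi_sub, Real.sin_pi, zero_add] at key
  have hterm : ∀ k ∈ Finset.range n, U.edge δ (k + j) * |Real.sin (j * δ - ((k + j : ℕ) : ℝ) * δ)|
      = (2 * Real.sin δ)⁻¹ * ((U.supp ((k + 1) * δ + j * δ) + U.supp ((k - 1) * δ + j * δ)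
        - 2 * Real.cos δ * U.supp (k * δ + j * δ)) * Real.sin (k * δ)) := by
    intro k hk
    have hk' : (k : ℝ) ≤ n := by exact_mod_cast (Finset.mem_range.1 hk).le
    have e0 : (j : ℝ) * δ - ((k + j : ℕ) : ℝ) * δ = -(k * δ) := by push_cast; ring
    have e1 : (((k + j : ℕ) : ℝ) + 1) * δ = (k + 1) * δ + j * δ := by push_cast; ring
    have e2 : (((k + j : ℕ) : ℝ) - 1) * δ = (k - 1) * δ + j * δ := by push_cast; ring
    have e3 : ((k + j : ℕ) : ℝ) * δ = k * δ + j * δ := by push_cast; ring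
    rw [e0, Real.sin_neg, abs_neg, abs_of_nonneg, edge, e1, e2, e3, div_eq_inv_mul, mul_assoc]
    exact Real.sin_nonneg_of_nonneg_of_le_pi (by positivity) (by rw [← hnδ]; gcongr)
  rw [Finset.sum_congr rfl hterm, ← Finset.mul_sum, key]
  field_simp
  ring

/-- The zonotope with edges parallel to those of the polygon circumscribed to `U` with normal
directions `k π / n`. -/
noncomputable def circumscribed (U : SymBody) (n : ℕ) : SymBody :=
  ∑ k ∈ Finset.range n, orthSeg (k * (Real.pi / n)) (U.edge (Real.pi / n) k)

theorem sin_pi_div_pos {n : ℕ} (hn : 2 ≤ n) : 0 < Real.sin (Real.pi / n) := by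
  have hn2 : (2 : ℝ) ≤ n := by exact_mod_cast hn
  exact Real.sin_pos_of_pos_of_lt_pi (by positivity)
    (div_lt_self Real.pi_pos (by linarith))

theorem supp_circumscribed (U : SymBody) {n : ℕ} (hn : 2 ≤ n) (θ : ℝ) :
    (U.circumscribed n).supp θ = ∑ k ∈ Finset.range n,
      U.edge (Real.pi / n) k * |Real.sin (θ - k * (Real.pi / n))| := by
  rw [circumscribed, supp_sum]
  exact Finset.sum_congr rfl fun k _ => supp_orthSeg _ (U.edge_nonneg (sin_pi_div_pos hn) k) _

theorem supp_circumscribed_grid (U : SymBody) {n : ℕ} (hn : 2 ≤ n) (j : ℕ) :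
    (U.circumscribed n).supp (j * (Real.pi / n)) = U.supp (j * (Real.pi / n)) := by
  rw [supp_circumscribed U hn, sum_edge_mul_abs_sin U hn]

theorem one_le_abs_sin_add_abs_cos (t : ℝ) : 1 ≤ |Real.sin t| + |Real.cos t| := by
  have h := Real.sin_sq_add_cos_sq t
  rw [← sq_abs, ← sq_abs (Real.cos t)] at h
  nlinarith [abs_nonneg (Real.sin t), abs_nonneg (Real.cos t),
    Real.abs_sin_le_one t, Real.abs_cos_le_one t]

/-- With an even number of directions both 0 and π/2 lie on the grid. Adding the two grid identities
gives every edge the weight |sin| + |cos| ≥ 1. The bound does not depend on m, so neither does the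
Lipschitz constant of the zonotopes. -/
theorem sum_edge_le (U : SymBody) {m : ℕ} (hm : 1 ≤ m) :
    ∑ k ∈ Finset.range (2 * m), U.edge (Real.pi / (2 * m : ℕ)) k
      ≤ U.supp 0 + U.supp (Real.pi / 2) := by
  have hm0 : (0 : ℝ) < m := by positivity
  have h0 := sum_edge_mul_abs_sin U (n := 2 * m) (by omega) 0
  have h1 := sum_edge_mul_abs_sin U (n := 2 * m) (by omega) m
  have e : (m : ℝ) * (Real.pi / (2 * m : ℕ)) = Real.pi / 2 := by push_cast; field_simp
  rw [e] at h1
  simp only [Nat.cast_zero, zero_mul, zero_sub, Real.sin_neg, abs_neg] at h0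
  rw [← h0, ← h1, ← Finset.sum_add_distrib]
  refine Finset.sum_le_sum fun k _ => ?_
  rw [Real.sin_pi_div_two_sub, ← mul_add]
  exact le_mul_of_one_le_right (U.edge_nonneg (sin_pi_div_pos (by omega)) k)
    (one_le_abs_sin_add_abs_cos _)

theorem abs_supp_circumscribed_sub_le (U : SymBody) {n : ℕ} (hn : 2 ≤ n) (θ θ' : ℝ) :
    |(U.circumscribed n).supp θ - (U.circumscribed n).supp θ'|
      ≤ (∑ k ∈ Finset.range n, U.edge (Real.pi / n) k) * |θ - θ'| := by
  rw [supp_circumscribed U hn, supp_circumscribed U hn, ← Finset.sum_sub_distrib, Finset.sum_mul]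
  refine (Finset.abs_sum_le_sum_abs _ _).trans (Finset.sum_le_sum fun k _ => ?_)
  have hk := U.edge_nonneg (sin_pi_div_pos hn) k
  rw [← mul_sub, abs_mul, abs_of_nonneg hk]
  refine mul_le_mul_of_nonneg_left ?_ hk
  refine (abs_abs_sub_abs_le_abs_sub _ _).trans ((Real.abs_sin_sub_sin_le _ _).trans_eq ?_)
  rw [sub_sub_sub_cancel_right]

/-- The two support functions agree at the grid point just below θ, at distance at most δ, and have
Lipschitz constants 4R and 2R. -/
theorem abs_supp_circumscribed_sub_supp_le {U : SymBody} {R : ℝ} (hR : 0 ≤ R)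
    (h : ∀ x ∈ U.toSet, |x 0| ≤ R ∧ |x 1| ≤ R) {m : ℕ} (hm : 1 ≤ m) {θ : ℝ} (hθ : 0 ≤ θ) :
    |(U.circumscribed (2 * m)).supp θ - U.supp θ| ≤ 6 * R * (Real.pi / (2 * m : ℕ)) := by
  have hn : 2 ≤ 2 * m := by omega
  set δ := Real.pi / (2 * m : ℕ) with hδ
  have hδ0 : 0 < δ := by positivity
  set j := ⌊θ / δ⌋₊ with hj
  have hj1 : j * δ ≤ θ := (le_div_iff₀ hδ0).1 (Nat.floor_le (by positivity))
  have hj2 : θ < (j + 1) * δ := (div_lt_iff₀ hδ0).1 (Nat.lt_floor_add_one _)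
  have hd : |θ - j * δ| ≤ δ := by rw [abs_of_nonneg (by linarith)]; linarith
  have h1 := U.abs_supp_circumscribed_sub_le hn θ (j * δ)
  rw [supp_circumscribed_grid U hn] at h1
  have h2 : (∑ k ∈ Finset.range (2 * m), U.edge (Real.pi / (2 * m : ℕ)) k) ≤ 4 * R := by
    linarith [U.sum_edge_le hm, supp_le_of_coord_bound h 0,
      supp_le_of_coord_bound h (Real.pi / 2)]
  have h3 : |U.supp (j * δ) - U.supp θ| ≤ 2 * R * |θ - j * δ| := by
    refine abs_sub_le_iff.2 ⟨?_, supp_sub_supp_le h _ _⟩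
    rw [abs_sub_comm]
    exact supp_sub_supp_le h _ _
  calc _ ≤ |(U.circumscribed (2 * m)).supp θ - U.supp (j * δ)| + |U.supp (j * δ) - U.supp θ| :=
        abs_sub_le _ _ _
    _ ≤ 4 * R * |θ - j * δ| + 2 * R * |θ - j * δ| :=
        add_le_add (h1.trans (mul_le_mul_of_nonneg_right h2 (abs_nonneg _))) h3
    _ = 6 * R * |θ - j * δ| := by ring
    _ ≤ _ := by gcongr

/-- The closed disc of radius `r` about the origin. -/
noncomputable def disc (r : ℝ) (hr : 0 ≤ r) : SymBody :=
  ofConvexBody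
    { carrier := Metric.closedBall 0 r
      convex' := convex_closedBall _ _
      isCompact' := isCompact_closedBall _ _
      nonempty' := Metric.nonempty_closedBall.2 hr } (by
    intro x hx
    have hx' : x ∈ Metric.closedBall (0 : Plane) r := hx
    show -x ∈ Metric.closedBall (0 : Plane) r
    simpa using hx')

theorem toSet_disc (r : ℝ) (hr : 0 ≤ r) : (disc r hr).toSet = Metric.closedBall 0 r := rfl

theorem le_supp_disc (r : ℝ) (hr : 0 ≤ r) (θ : ℝ) : r ≤ (disc r hr).supp θ := by
  have hx : !₂[r * Real.cos θ, r * Real.sin θ] ∈ (disc r hr).toSet := by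
    rw [toSet_disc, mem_closedBall_zero_iff, ← sq_le_sq₀ (norm_nonneg _) hr,
      EuclideanSpace.real_norm_sq_eq, Fin.sum_univ_two]
    simp
    nlinarith [Real.sin_sq_add_cos_sq θ]
  refine le_trans (le_of_eq ?_) (dirForm_le_supp hx θ)
  rw [dirForm_apply]
  simp
  linear_combination -r * Real.sin_sq_add_cos_sq θ

/-- The square with half-side `c` and sides parallel to the axes. -/
noncomputable def square (c : ℝ) : SymBody := orthSeg 0 c + orthSeg (Real.pi / 2) c

theorem supp_square {c : ℝ} (hc : 0 ≤ c) (θ : ℝ) :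
    (square c).supp θ = c * (|Real.sin θ| + |Real.cos θ|) := by
  rw [square, supp_add, supp_orthSeg _ hc, supp_orthSeg _ hc, sub_zero, Real.sin_sub_pi_div_two,
    abs_neg, mul_add]

/-- Every planar symmetric body is approximated from outside by zonotopes. -/
theorem exists_zonotope_approx (W : SymBody) {ε : ℝ} (hε : 0 < ε) :
    ∃ Z ∈ AddSubmonoid.closure {S | ∃ φ c, 0 ≤ c ∧ S = orthSeg φ c},
      W.toSet ⊆ Z.toSet ∧ Z.toSet ⊆ W.toSet + Metric.closedBall 0 ε := by
  obtain ⟨R, hR, hW⟩ := W.exists_coord_bound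
  -- The zonotope's support function is within η of that of W. The added square raises it by between
  -- η and 2η, so the total excess lies in [0, 3η], and 3η = 9Rπ/m.
  obtain ⟨m, hm⟩ := exists_nat_gt (9 * R * Real.pi / ε)
  have hm0 : (0 : ℝ) < m := lt_of_le_of_lt (by positivity) hm
  have hm1 : 1 ≤ m := by exact_mod_cast hm0
  set η := 6 * R * (Real.pi / (2 * m : ℕ)) with hη
  have hη0 : 0 ≤ η := by positivity
  have hηε : 3 * η ≤ ε := by
    rw [div_lt_iff₀ hε] at hm
    have : 3 * η = 9 * R * Real.pi / m := by rw [hη]; push_cast; field_simp; norm_num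
    rw [this, div_le_iff₀ hm0]
    linarith
  have hcl : ∀ φ {c : ℝ}, 0 ≤ c → orthSeg φ c ∈
      AddSubmonoid.closure {S | ∃ φ c, 0 ≤ c ∧ S = orthSeg φ c} := fun φ c hc =>
    AddSubmonoid.subset_closure ⟨φ, c, hc, rfl⟩
  refine ⟨W.circumscribed (2 * m) + square η, add_mem
    (sum_mem fun k _ => hcl _ (W.edge_nonneg (sin_pi_div_pos (by omega)) k))
    (add_mem (hcl _ hη0) (hcl _ hη0)), ?_, ?_⟩
  · refine subset_of_supp_le fun θ hθ => ?_
    have h := (abs_le.1 (abs_supp_circumscribed_sub_supp_le hR.le hW hm1 hθ)).1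
    rw [supp_add, supp_square hη0]
    nlinarith [one_le_abs_sin_add_abs_cos θ]
  · rw [← toSet_disc ε hε.le, ← toSet_add]
    refine subset_of_supp_le fun θ hθ => ?_
    have h := (abs_le.1 (abs_supp_circumscribed_sub_supp_le hR.le hW hm1 hθ)).2
    rw [supp_add, supp_add, supp_square hη0]
    nlinarith [Real.abs_sin_le_one θ, Real.abs_cos_le_one θ, le_supp_disc ε hε.le θ]

/-! ### Area and mixed area. -/

theorem area_mono {U V : SymBody} (h : U.toSet ⊆ V.toSet) : U.area ≤ V.area :=
  ENNReal.toReal_mono V.volume_toSet_ne_top (measure_mono h)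

theorem area_smul (c : ℝ≥0) (U : SymBody) : (c • U).area = (c : ℝ) ^ 2 * U.area := by
  rw [area, toSet_smul, Measure.addHaar_smul, finrank_euclideanSpace_fin, ENNReal.toReal_mul,
    ENNReal.toReal_ofReal (abs_nonneg _), abs_of_nonneg (sq_nonneg _), area]

theorem area_zero : (0 : SymBody).area = 0 := by
  simpa using area_smul 0 0

theorem area_add_self (U : SymBody) : (U + U).area = 4 * U.area := by
  rw [← two_smul ℝ≥0 U, area_smul]
  norm_num

theorem area_disc_pos : 0 < (disc 1 zero_le_one).area :=
  ENNReal.toReal_pos (Metric.measure_closedBall_pos _ _ one_pos).ne' (volume_toSet_ne_top _)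

/-- The mixed area of two bodies, normalised so that `mixedArea U U = area U`. -/
noncomputable def mixedArea (U V : SymBody) : ℝ := ((U + V).area - U.area - V.area) / 2

theorem mixedArea_comm (U V : SymBody) : U.mixedArea V = V.mixedArea U := by
  rw [mixedArea, mixedArea, add_comm]
  ring

theorem mixedArea_orthSeg (U : SymBody) (φ : ℝ) {c : ℝ} (hc : 0 ≤ c) :
    U.mixedArea (orthSeg φ c) = 2 * c * U.supp φ := by
  have h := area_add_orthSeg 0 φ hc
  rw [zero_add, area_zero, supp_zero] at h
  rw [mixedArea, area_add_orthSeg U φ hc, h]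
  ring

/-- Mixed area with `Z` is linear. -/
def HasLinearMixedArea (Z : SymBody) : Prop :=
  (∀ U V : SymBody, (U + V).mixedArea Z = U.mixedArea Z + V.mixedArea Z) ∧
    ∀ (c : ℝ≥0) (U : SymBody), (c • U).mixedArea Z = c * U.mixedArea Z

/-- The defect V(U, Z + Z') - V(U, Z) - V(U, Z') is symmetric in the three bodies, so additivity in
the first argument against Z' already makes it vanish. -/
theorem HasLinearMixedArea.mixedArea_add_right {Z' : SymBody} (h : Z'.HasLinearMixedArea)
    (U Z : SymBody) : U.mixedArea (Z + Z') = U.mixedArea Z + U.mixedArea Z' := by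
  have h1 := h.1 U Z
  simp only [mixedArea, add_assoc] at h1 ⊢
  linarith

theorem hasLinearMixedArea_zero : (0 : SymBody).HasLinearMixedArea := by
  simp [HasLinearMixedArea, mixedArea, area_zero]

theorem HasLinearMixedArea.add {Z Z' : SymBody} (h : Z.HasLinearMixedArea)
    (h' : Z'.HasLinearMixedArea) : (Z + Z').HasLinearMixedArea := by
  refine ⟨fun U V => ?_, fun c U => ?_⟩
  · simp only [h'.mixedArea_add_right, h.1, h'.1]
    ring
  · simp only [h'.mixedArea_add_right, h.2, h'.2]
    ring

theorem hasLinearMixedArea_orthSeg (φ : ℝ) {c : ℝ} (hc : 0 ≤ c) :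
    (orthSeg φ c).HasLinearMixedArea := by
  refine ⟨fun U V => ?_, fun a U => ?_⟩
  · simp only [mixedArea_orthSeg _ φ hc, supp_add]
    ring
  · simp only [mixedArea_orthSeg _ φ hc, supp_smul]
    ring

theorem hasLinearMixedArea_of_mem_closure {Z : SymBody}
    (hZ : Z ∈ AddSubmonoid.closure {S | ∃ φ c, 0 ≤ c ∧ S = orthSeg φ c}) :
    Z.HasLinearMixedArea := by
  induction hZ using AddSubmonoid.closure_induction with
  | mem S h =>
    obtain ⟨φ, c, hc, rfl⟩ := h
    exact hasLinearMixedArea_orthSeg φ hc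
  | zero => exact hasLinearMixedArea_zero
  | add S T _ _ hS hT => exact hS.add hT

-- A squeeze: X + Z n contains X + W and lies in its closed ε n-thickening, whose measure tends to
-- that of the compact set X + W.
open Filter Topology in
theorem tendsto_area_add {W : SymBody} {Z : ℕ → SymBody} {ε : ℕ → ℝ} (hε : ∀ n, 0 ≤ ε n)
    (hε0 : Tendsto ε atTop (𝓝 0)) (h₁ : ∀ n, W.toSet ⊆ (Z n).toSet)
    (h₂ : ∀ n, (Z n).toSet ⊆ W.toSet + Metric.closedBall 0 (ε n)) (X : SymBody) :
    Tendsto (fun n => (X + Z n).area) atTop (𝓝 (X + W).area) := by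
  have hcl : Tendsto (fun n => (volume (Metric.cthickening (ε n) (X + W).toSet)).toReal) atTop
      (𝓝 (X + W).area) :=
    (ENNReal.tendsto_toReal (X + W).volume_toSet_ne_top).comp
      ((tendsto_measure_cthickening_of_isCompact (X + W).isCompact_toSet).comp hε0)
  refine tendsto_of_tendsto_of_tendsto_of_le_of_le tendsto_const_nhds hcl
    (fun n => area_mono (Set.add_subset_add_left (h₁ n))) fun n => ?_
  refine ENNReal.toReal_mono (X + W).isCompact_toSet.cthickening.measure_ne_top (measure_mono ?_)
  rw [← (X + W).isCompact_toSet.add_closedBall_zero (hε n), toSet_add, toSet_add, add_assoc]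
  exact Set.add_subset_add_left (h₂ n)

open Filter Topology in
/-- Mixed area in the plane is linear in each argument. -/
theorem hasLinearMixedArea (W : SymBody) : W.HasLinearMixedArea := by
  have hpos (n : ℕ) : (0 : ℝ) < 1 / ((n : ℝ) + 1) := by positivity
  choose Z hZ h₁ h₂ using fun n : ℕ => W.exists_zonotope_approx (hpos n)
  have hlin (n : ℕ) : (Z n).HasLinearMixedArea := hasLinearMixedArea_of_mem_closure (hZ n)
  have htend (X : SymBody) : Tendsto (fun n => (X + Z n).area) atTop (𝓝 (X + W).area) :=
    tendsto_area_add (fun n => (hpos n).le) tendsto_one_div_add_atTop_nhds_zero_nat h₁ h₂ X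
  have hmix (X : SymBody) :
      Tendsto (fun n => X.mixedArea (Z n)) atTop (𝓝 (X.mixedArea W)) := by
    have h0 := htend 0
    simp only [zero_add] at h0
    exact (((htend X).sub_const _).sub h0).div_const 2
  refine ⟨fun U V => tendsto_nhds_unique (hmix (U + V)) ?_,
    fun c U => tendsto_nhds_unique (hmix (c • U)) ?_⟩
  · simp only [(hlin _).1]
    exact (hmix U).add (hmix V)
  · simp only [(hlin _).2]
    exact (hmix U).const_mul _

/-- Mixed area as a bilinear map on the cone of symmetric bodies. -/
noncomputable def mixedAreaBilin : SymBody →ₗ[ℝ≥0] SymBody →ₗ[ℝ≥0] ℝ :=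
  LinearMap.mk₂ ℝ≥0 mixedArea (fun U V W => W.hasLinearMixedArea.1 U V)
    (fun c U W => W.hasLinearMixedArea.2 c U)
    (fun U V W => W.hasLinearMixedArea.mixedArea_add_right U V)
    (fun c U W => by
      rw [mixedArea_comm, U.hasLinearMixedArea.2 c W, mixedArea_comm, NNReal.smul_def, smul_eq_mul])

end SymBody

/-! ### Extension to formal differences and uniqueness. -/

namespace DiffSpace

/-- The linear extension to the space of formal differences of a linear map on the cone. -/
noncomputable def lift {E : Type*} [AddCommGroup E] [Module ℝ E] (f : SymBody →ₗ[ℝ≥0] E) :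
    DiffSpace →ₗ[ℝ] E where
  toFun := Quotient.lift (fun a => f a.1 - f a.2) (by
    intro a b h
    have h' : a.1 + b.2 = a.2 + b.1 := h
    have := congrArg f h'
    rw [map_add, map_add] at this
    show f a.1 - f a.2 = f b.1 - f b.2
    rw [sub_eq_sub_iff_add_eq_add, this, add_comm])
  map_add' x y := by
    induction x using ind with | _ U V
    induction y using ind with | _ P Q
    show f (U + P) - f (V + Q) = (f U - f V) + (f P - f Q)
    rw [map_add, map_add]
    abel
  map_smul' r x := by
    induction x using ind with | _ U V
    obtain ⟨a, b, rfl⟩ := exists_eq_sub r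
    rw [sub_smul_mk]
    show f (a • U + b • V) - f (a • V + b • U) = ((a : ℝ) - b) • (f U - f V)
    simp only [map_add, map_smul, NNReal.smul_def]
    module

theorem lift_mk {E : Type*} [AddCommGroup E] [Module ℝ E] (f : SymBody →ₗ[ℝ≥0] E)
    (U V : SymBody) : lift f (mk U V) = f U - f V := rfl

/-- The mixed area form on the space of formal differences. -/
noncomputable def mixedAreaForm : LinearMap.BilinForm ℝ DiffSpace :=
  lift
    { toFun := fun U => lift (SymBody.mixedAreaBilin U)
      map_add' := fun U V => by
        ext x
        induction x using ind with | _ P Q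
        simp only [LinearMap.add_apply, lift_mk, map_add]
        ring
      map_smul' := fun c U => by
        ext x
        induction x using ind with | _ P Q
        simp only [LinearMap.smul_apply, lift_mk, map_smul, RingHom.id_apply, smul_sub] }

theorem mixedAreaForm_mk (U V P Q : SymBody) : mixedAreaForm (mk U V) (mk P Q) =
    ((U + P).area + (V + Q).area - (U + Q).area - (V + P).area) / 2 := by
  -- The areas of the single bodies cancel in this alternating sum.
  show (U.mixedArea P - U.mixedArea Q) - (V.mixedArea P - V.mixedArea Q) = _
  simp only [SymBody.mixedArea]
  ring

theorem isSymm_mixedAreaForm : mixedAreaForm.IsSymm := ⟨fun x y => by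
  induction x using ind with | _ U V
  induction y using ind with | _ P Q
  rw [mixedAreaForm_mk, mixedAreaForm_mk, add_comm U P, add_comm V Q, add_comm U Q, add_comm V P]
  ring⟩

theorem mixedAreaForm_self (U V : SymBody) : mixedAreaForm (mk U V) (mk U V) =
    2 * U.area + 2 * V.area - (U + V).area := by
  rw [mixedAreaForm_mk, SymBody.area_add_self, SymBody.area_add_self, add_comm V U]
  ring

theorem mk_eq_embed_sub_embed (U V : SymBody) : mk U V = embed U - embed V := by
  rw [sub_eq_add_neg, embed, embed, neg_mk, mk_add_mk, add_zero, zero_add]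

theorem embed_add (U V : SymBody) : embed (U + V) = embed U + embed V := by
  rw [embed, embed, embed, mk_add_mk, add_zero]

theorem embed_smul (c : ℝ≥0) (U : SymBody) : embed (c • U) = (c : ℝ) • embed U := by
  rw [embed, embed, nnreal_smul_mk, smul_zero]

/-- A polynomial of degree at most two that extends the area is determined by it. -/
theorem polynomial_extending_area_eq {w : DiffSpace → ℝ} (hw : IsPolyOfDegreeLETwo w)
    (h : ∀ U : SymBody, w (embed U) = U.area) (U V : SymBody) :
    w (mk U V) = 2 * U.area + 2 * V.area - (U + V).area := by
  obtain ⟨q, l, c, hq⟩ := hw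
  -- Restriction to a ray: t = 0 gives the constant term, and t = 1, 2 separate the linear from the
  -- quadratic part.
  have hpoly (t : ℝ≥0) (U : SymBody) :
      (t : ℝ) ^ 2 * q (embed U) + t * l (embed U) + c = (t : ℝ) ^ 2 * U.area := by
    rw [← SymBody.area_smul, ← h, embed_smul, hq, QuadraticMap.map_smul, map_smul, smul_eq_mul,
      smul_eq_mul]
    ring
  have hc : c = 0 := by simpa using hpoly 0 U
  have hl (U : SymBody) : l (embed U) = 0 := by
    have h1 := hpoly 1 U
    have h2 := hpoly 2 U
    push_cast at h1 h2
    linarith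
  have hqa (U : SymBody) : q (embed U) = U.area := by
    simpa [hc, hl] using hpoly 1 U
  have hsub : q (embed U - embed V)
      = 2 * q (embed U) + 2 * q (embed V) - q (embed U + embed V) := by
    have h1 := QuadraticMap.map_add q (embed U) (embed V)
    have h2 := QuadraticMap.map_add q (embed U) (-embed V)
    rw [QuadraticMap.polar_neg_right, QuadraticMap.map_neg, ← sub_eq_add_neg] at h2
    linarith
  rw [hq, mk_eq_embed_sub_embed, map_sub l, hl, hl, hc, hsub, ← embed_add, hqa, hqa, hqa]
  ring

end DiffSpace

/-! ### The main theorem. -/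

theorem mainTheorem1 :
    ∃ mstar : QuadraticForm ℝ DiffSpace,
      mstar ≠ 0 ∧
      (∀ U : SymBody, mstar (DiffSpace.embed U) = U.area) ∧
      (∀ w : DiffSpace → ℝ, IsPolyOfDegreeLETwo w →
        (∀ U : SymBody, w (DiffSpace.embed U) = U.area) → ∀ x, w x = mstar x) ∧
      (∀ U V : SymBody,
        mstar (DiffSpace.mk U V) = 2 * U.area + 2 * V.area - (U + V).area) ∧
      ∃ M : LinearMap.BilinForm ℝ DiffSpace,
        M.IsSymm ∧
        (∀ U V P Q : SymBody,
          M (DiffSpace.mk U V) (DiffSpace.mk P Q) =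
            ((U + P).area + (V + Q).area - (U + Q).area - (V + P).area) / 2) ∧
        ∀ x, mstar x = M x x := by
  have hmk (U V : SymBody) : DiffSpace.mixedAreaForm.toQuadraticMap (DiffSpace.mk U V)
      = 2 * U.area + 2 * V.area - (U + V).area := by
    rw [LinearMap.BilinMap.toQuadraticMap_apply, DiffSpace.mixedAreaForm_self]
  have hembed (U : SymBody) :
      DiffSpace.mixedAreaForm.toQuadraticMap (DiffSpace.embed U) = U.area := by
    rw [DiffSpace.embed, hmk, SymBody.area_zero, add_zero]
    ring
  refine ⟨DiffSpace.mixedAreaForm.toQuadraticMap, ?_, hembed, ?_, hmk, DiffSpace.mixedAreaForm,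
    DiffSpace.isSymm_mixedAreaForm, DiffSpace.mixedAreaForm_mk, fun x => rfl⟩
  · intro h0
    have h := hembed (SymBody.disc 1 zero_le_one)
    rw [h0, zero_apply] at h
    exact SymBody.area_disc_pos.ne h
  · intro w hw h x
    induction x using DiffSpace.ind with | _ U V
    rw [hmk, DiffSpace.polynomial_extending_area_eq hw h]
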